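/- All graphs are finite and simple. A matching of a graph $G$ is a set $M \subseteq E(G)$ of pairwise disjoint edges; it is maximal if $M \cup \{e\}$ is not a matching for every $e \in E(G) \setminus M$, and induced if for all distinct $e, f \in M$ no edge $g \in E(G)$ satisfies both $e \cap g \neq \emptyset$ and $f \cap g \neq \emptyset$. Let $\mathrm{match}(G)$ be the maximum size of a matching of $G$, $\text{min-match}(G)$ the minimum size of a maximal matching of $G$, and $\text{ind-match}(G)$ the maximum size of an induced matching of $G$. For integers $1 \le p \le q \le r \le 2q$ let $$\min(p,q,r;|V|) = \min\{\, |V(G)| : G \text{ is a connected graph with } \text{ind-match}(G)=p,\ \text{min-match}(G)=q,\ \mathrm{match}(G)=r \,\}.$$ Theorem. Let $p, q, r$ be integers with $1 \le p \le q \le r \le 2q$. Then the following hold, where in each case the set in question is non-empty, so that the minimum is attained. 1. $\min(1,q,r;|V|) = 2r$. 2. If $2 \le p \le q < r \le 2q$, then $\min(p,q,r;|V|) = 2r$. 3. If $2 \le p \le q = r$, then $\min(p,r,r;|V|) = 2r+1$. -/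

import Mathlib

namespace SimpleGraph

/-- A set `M` of edges of `G` is a matching if distinct members of `M` share no vertex. -/
def IsEdgeMatching {V : Type*} (G : SimpleGraph V) (M : Set (Sym2 V)) : Prop :=
  M ⊆ G.edgeSet ∧ ∀ e ∈ M, ∀ f ∈ M, e ≠ f → ¬ ∃ v : V, v ∈ e ∧ v ∈ f

/-- A maximal matching: adding any further edge of `G` destroys the matching property. -/
def IsMaximalMatching {V : Type*} (G : SimpleGraph V) (M : Set (Sym2 V)) : Prop :=
  G.IsEdgeMatching M ∧ ∀ e ∈ G.edgeSet \ M, ¬ G.IsEdgeMatching (insert e M)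

/-- An induced matching: no edge `g` of `G` meets two distinct members of `M`. -/
def IsInducedMatching {V : Type*} (G : SimpleGraph V) (M : Set (Sym2 V)) : Prop :=
  G.IsEdgeMatching M ∧ ∀ e ∈ M, ∀ f ∈ M, e ≠ f →
    ¬ ∃ g ∈ G.edgeSet, (∃ v : V, v ∈ e ∧ v ∈ g) ∧ (∃ w : V, w ∈ f ∧ w ∈ g)

/-- The matching number: the largest size of a matching of a finite graph. -/
noncomputable def matchingNumber {V : Type*} [Fintype V] (G : SimpleGraph V) : ℕ :=
  sSup {n : ℕ | ∃ M : Set (Sym2 V), G.IsEdgeMatching M ∧ M.ncard = n}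

/-- The minimum matching number: the smallest size of a maximal matching of a finite graph. -/
noncomputable def minMatchingNumber {V : Type*} [Fintype V] (G : SimpleGraph V) : ℕ :=
  sInf {n : ℕ | ∃ M : Set (Sym2 V), G.IsMaximalMatching M ∧ M.ncard = n}

/-- The induced matching number: the largest size of an induced matching of a finite graph. -/
noncomputable def inducedMatchingNumber {V : Type*} [Fintype V] (G : SimpleGraph V) : ℕ :=
  sSup {n : ℕ | ∃ M : Set (Sym2 V), G.IsInducedMatching M ∧ M.ncard = n}

/-- The numbers of vertices of finite connected simple graphs with induced matching number `p`,
minimum matching number `q` and matching number `r`. The quantity `min(p, q, r; |V|)` is the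
least element of this set. -/
def vertexCounts (p q r : ℕ) : Set ℕ :=
  {n : ℕ | ∃ (V : Type) (_ : Fintype V) (G : SimpleGraph V), Fintype.card V = n ∧ G.Connected ∧
    G.inducedMatchingNumber = p ∧ G.minMatchingNumber = q ∧ G.matchingNumber = r}

end SimpleGraph

/-! A matching of size `r` needs `2r` vertices. If `q = r` and there are only `2r` vertices, every
maximal matching is perfect. Exchanging edges then shows that the ends of any path on four vertices
are adjacent, so in a connected graph no two edges form an induced matching
(`inducedMatchingNumber_le_one_of_forall_maximal_covers`). Hence `p ≥ 2` forces an extra vertex.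

The bounds are attained by a hub joined to everything, plus `p` colour classes that are cliques
except inside an independent set `I`. Colours count induced edges. Four-vertex cells (two vertices
in `I`, two outside) contain two disjoint edges, but one edge already covers their part outside `I`;
two-vertex cells contribute one edge to either count. The crux is
`ncard_compl_le_of_isMaximalMatching_hubGraph`: a maximal matching covers at least `|Iᶜ| - 1`
vertices. When `q = r` and `p ≥ 2`, the hub is the extra vertex and `I` is empty. -/

namespace SimpleGraph

/-! ### Matchings and the vertices they cover -/

variable {V : Type*} {G : SimpleGraph V} {M : Set (Sym2 V)}

/-- The vertices covered by a set of edges. -/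
def coveredBy (M : Set (Sym2 V)) : Set V := {v | ∃ e ∈ M, v ∈ e}

theorem IsEdgeMatching.subset {N : Set (Sym2 V)} (hM : G.IsEdgeMatching M) (h : N ⊆ M) :
    G.IsEdgeMatching N :=
  ⟨h.trans hM.1, fun e he f hf => hM.2 e (h he) f (h hf)⟩

theorem IsEdgeMatching.eq_of_mem (hM : G.IsEdgeMatching M) {e f : Sym2 V} {v : V}
    (he : e ∈ M) (hf : f ∈ M) (hve : v ∈ e) (hvf : v ∈ f) : e = f := by
  by_contra h
  exact hM.2 e he f hf h ⟨v, hve, hvf⟩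

theorem IsEdgeMatching.insert {e : Sym2 V} (hM : G.IsEdgeMatching M) (he : e ∈ G.edgeSet)
    (h : ∀ v ∈ e, v ∉ coveredBy M) : G.IsEdgeMatching (insert e M) := by
  refine ⟨Set.insert_subset he hM.1, ?_⟩
  rintro a (rfl | ha) b (rfl | hb) hab ⟨v, hva, hvb⟩
  · exact hab rfl
  · exact h v hva ⟨b, hb, hvb⟩
  · exact h v hvb ⟨a, ha, hva⟩
  · exact hM.2 a ha b hb hab ⟨v, hva, hvb⟩

theorem isEdgeMatching_singleton {e : Sym2 V} (he : e ∈ G.edgeSet) : G.IsEdgeMatching {e} := by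
  refine ⟨by simpa using he, ?_⟩
  rintro a rfl b rfl h
  exact absurd rfl h

/-- Turns maximality into a vertex condition: the uncovered vertices are independent. -/
theorem isMaximalMatching_iff : G.IsMaximalMatching M ↔
    G.IsEdgeMatching M ∧ ∀ u w, G.Adj u w → u ∈ coveredBy M ∨ w ∈ coveredBy M := by
  constructor
  · rintro ⟨hM, hmax⟩
    refine ⟨hM, fun u w huw => ?_⟩
    by_contra! h
    refine hmax s(u, w) ⟨huw, fun hmem => h.1 ⟨_, hmem, by simp⟩⟩ (hM.insert huw ?_)
    intro v hv
    rcases Sym2.mem_iff.1 hv with rfl | rfl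
    exacts [h.1, h.2]
  · rintro ⟨hM, hcov⟩
    refine ⟨hM, ?_⟩
    rintro e ⟨he, heM⟩ hins
    induction e with | _ u w
    have key : ∀ v ∈ s(u, w), v ∉ coveredBy M := by
      rintro v hv ⟨f, hf, hvf⟩
      exact heM (hins.eq_of_mem (Set.mem_insert _ _) (Set.mem_insert_of_mem _ hf) hv hvf ▸ hf)
    rcases hcov u w he with h | h
    · exact key u (by simp) h
    · exact key w (by simp) h

theorem IsEdgeMatching.ncard_coveredBy [Finite V] (hM : G.IsEdgeMatching M) :
    (coveredBy M).ncard = 2 * M.ncard := by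
  classical
  cases nonempty_fintype V
  have : coveredBy M = ↑(M.toFinset.biUnion Sym2.toFinset) := by
    ext v
    simp [coveredBy]
  rw [this, Set.ncard_coe_finset, Finset.card_biUnion, Finset.sum_congr rfl (g := fun _ => 2),
    Finset.sum_const, Set.ncard_eq_toFinset_card', smul_eq_mul, mul_comm]
  · intro e he
    exact Sym2.card_toFinset_of_not_isDiag _
      (G.not_isDiag_of_mem_edgeSet (hM.1 (Set.mem_toFinset.1 he)))
  · intro e he f hf hef
    refine Finset.disjoint_left.2 fun v hve hvf => ?_
    exact hM.2 e (Set.mem_toFinset.1 he) f (Set.mem_toFinset.1 hf) hef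
      ⟨v, Sym2.mem_toFinset.1 hve, Sym2.mem_toFinset.1 hvf⟩

theorem IsEdgeMatching.two_mul_ncard_le [Fintype V] (hM : G.IsEdgeMatching M) :
    2 * M.ncard ≤ Fintype.card V := by
  rw [← hM.ncard_coveredBy, ← Nat.card_eq_fintype_card]
  exact Set.ncard_le_card _

/-- A matching that does not leave `S` covers an even number of vertices of `S`. -/
theorem IsEdgeMatching.even_ncard_coveredBy_inter [Finite V] (hM : G.IsEdgeMatching M)
    {S : Set V} (hS : ∀ e ∈ M, ∀ u ∈ e, ∀ w ∈ e, u ∈ S → w ∈ S) :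
    Even (coveredBy M ∩ S).ncard := by
  have h := (hM.subset (N := {e ∈ M | ∀ u ∈ e, u ∈ S}) (Set.sep_subset _ _)).ncard_coveredBy
  have h2 : coveredBy {e ∈ M | ∀ u ∈ e, u ∈ S} = coveredBy M ∩ S := by
    ext v
    constructor
    · rintro ⟨e, ⟨he, heS⟩, hv⟩
      exact ⟨⟨e, he, hv⟩, heS v hv⟩
    · rintro ⟨⟨e, he, hv⟩, hvS⟩
      exact ⟨e, ⟨he, fun u hu => hS e he v hv u hu hvS⟩, hv⟩
  rw [← h2, h]
  exact even_two_mul _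

/-! ### Matchings given by two families of vertices -/

section Pairing

variable {ι : Type*} {x y : ι → V}

theorem isEdgeMatching_range (hadj : ∀ i, G.Adj (x i) (y i))
    (hinj : Function.Injective (Sum.elim x y)) :
    G.IsEdgeMatching (Set.range fun i => s(x i, y i)) := by
  refine ⟨?_, ?_⟩
  · rintro _ ⟨i, rfl⟩
    exact hadj i
  · rintro _ ⟨i, rfl⟩ _ ⟨j, rfl⟩ hij ⟨v, hi, hj⟩
    have hne : i ≠ j := fun h => hij (by rw [h])
    rcases Sym2.mem_iff.1 hi with rfl | rfl <;> rcases Sym2.mem_iff.1 hj with h | h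
    · exact hne (Sum.inl_injective (@hinj (Sum.inl i) (Sum.inl j) h))
    · simpa using @hinj (Sum.inl i) (Sum.inr j) h
    · simpa using @hinj (Sum.inr i) (Sum.inl j) h
    · exact hne (Sum.inr_injective (@hinj (Sum.inr i) (Sum.inr j) h))

theorem ncard_range_pairing [Fintype ι] (hinj : Function.Injective (Sum.elim x y)) :
    (Set.range fun i => s(x i, y i)).ncard = Fintype.card ι := by
  rw [← Set.image_univ, Set.ncard_image_of_injective, Set.ncard_univ, Nat.card_eq_fintype_card]
  intro i j hij
  rcases Sym2.eq_iff.1 hij with h | h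
  · exact Sum.inl_injective (@hinj (Sum.inl i) (Sum.inl j) h.1)
  · simpa using @hinj (Sum.inl i) (Sum.inr j) h.1

theorem coveredBy_range_pairing :
    coveredBy (Set.range fun i => s(x i, y i)) = Set.range x ∪ Set.range y := by
  ext v
  constructor
  · rintro ⟨_, ⟨i, rfl⟩, hv⟩
    rcases Sym2.mem_iff.1 hv with rfl | rfl
    exacts [Or.inl ⟨i, rfl⟩, Or.inr ⟨i, rfl⟩]
  · rintro (⟨i, rfl⟩ | ⟨i, rfl⟩) <;> exact ⟨_, ⟨i, rfl⟩, by simp⟩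

end Pairing

theorem isEdgeMatching_empty : G.IsEdgeMatching ∅ := by simp [IsEdgeMatching]

/-! ### The three matching numbers as attained extrema -/

section Numbers

variable [Fintype V]

theorem bddAbove_matching :
    BddAbove {n : ℕ | ∃ M : Set (Sym2 V), G.IsEdgeMatching M ∧ M.ncard = n} := by
  refine ⟨Fintype.card V, ?_⟩
  rintro _ ⟨M, hM, rfl⟩
  have := hM.two_mul_ncard_le
  lia

theorem IsEdgeMatching.ncard_le (hM : G.IsEdgeMatching M) : M.ncard ≤ G.matchingNumber :=
  le_csSup bddAbove_matching ⟨M, hM, rfl⟩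

variable (G) in
theorem exists_isEdgeMatching_ncard_eq :
    ∃ M, G.IsEdgeMatching M ∧ M.ncard = G.matchingNumber :=
  Nat.sSup_mem (s := {n : ℕ | ∃ M : Set (Sym2 V), G.IsEdgeMatching M ∧ M.ncard = n})
    ⟨_, ∅, isEdgeMatching_empty, rfl⟩ bddAbove_matching

variable (G) in
theorem two_mul_matchingNumber_le : 2 * G.matchingNumber ≤ Fintype.card V := by
  obtain ⟨M, hM, h⟩ := G.exists_isEdgeMatching_ncard_eq
  exact h ▸ hM.two_mul_ncard_le

theorem IsMaximalMatching.le_ncard (hM : G.IsMaximalMatching M) :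
    G.minMatchingNumber ≤ M.ncard :=
  Nat.sInf_le ⟨M, hM, rfl⟩

/-- Every matching of a finite graph extends to a maximal one. -/
theorem IsEdgeMatching.exists_isMaximalMatching (hM : G.IsEdgeMatching M) :
    ∃ N, M ⊆ N ∧ G.IsMaximalMatching N := by
  obtain ⟨N, hMN, hN⟩ := Set.Finite.exists_le_maximal
    (Set.toFinite {N : Set (Sym2 V) | G.IsEdgeMatching N}) hM
  refine ⟨N, hMN, hN.prop, fun e he hins => he.2 ?_⟩
  exact hN.le_of_ge hins (Set.subset_insert _ _) (Set.mem_insert _ _)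

variable (G) in
theorem exists_isMaximalMatching_ncard_eq :
    ∃ M, G.IsMaximalMatching M ∧ M.ncard = G.minMatchingNumber := by
  obtain ⟨N, -, hN⟩ := (isEdgeMatching_empty (G := G)).exists_isMaximalMatching
  exact Nat.sInf_mem (s := {n : ℕ | ∃ M : Set (Sym2 V), G.IsMaximalMatching M ∧ M.ncard = n})
    ⟨_, N, hN, rfl⟩

theorem bddAbove_inducedMatching :
    BddAbove {n : ℕ | ∃ M : Set (Sym2 V), G.IsInducedMatching M ∧ M.ncard = n} :=
  (bddAbove_matching (G := G)).mono (by rintro _ ⟨M, hM, h⟩; exact ⟨M, hM.1, h⟩)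

theorem IsInducedMatching.ncard_le (hM : G.IsInducedMatching M) :
    M.ncard ≤ G.inducedMatchingNumber :=
  le_csSup bddAbove_inducedMatching ⟨M, hM, rfl⟩

variable (G) in
theorem exists_isInducedMatching_ncard_eq :
    ∃ M, G.IsInducedMatching M ∧ M.ncard = G.inducedMatchingNumber :=
  Nat.sSup_mem (s := {n : ℕ | ∃ M : Set (Sym2 V), G.IsInducedMatching M ∧ M.ncard = n})
    ⟨_, ∅, And.intro isEdgeMatching_empty (by simp), rfl⟩ bddAbove_inducedMatching

end Numbers

/-! ### Graphs whose maximal matchings are all perfect -/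

section RandomlyMatchable

/-- If every maximal matching covers all vertices, then the ends of a path on four vertices are
adjacent. -/
theorem adj_of_path_of_forall_maximal_covers [Fintype V]
    (hG : ∀ M, G.IsMaximalMatching M → coveredBy M = Set.univ) {x a b y : V}
    (hxa : G.Adj x a) (hab : G.Adj a b) (hby : G.Adj b y) (hxb : x ≠ b) (hay : a ≠ y)
    (hxy : x ≠ y) : G.Adj x y := by
  have hM₀ : G.IsEdgeMatching {s(x, a), s(b, y)} := by
    refine (isEdgeMatching_singleton (e := s(b, y)) hby).insert (e := s(x, a)) hxa ?_
    rintro v hv ⟨e, rfl, hve⟩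
    rcases Sym2.mem_iff.1 hv with rfl | rfl <;> rcases Sym2.mem_iff.1 hve with h | h
    · exact hxb h
    · exact hxy h
    · exact hab.ne h
    · exact hay h
  obtain ⟨N, hsub, hN⟩ := hM₀.exists_isMaximalMatching
  have hxaN : s(x, a) ∈ N := hsub (by simp)
  have hbyN : s(b, y) ∈ N := hsub (by simp)
  have hR : G.IsEdgeMatching (N \ {s(x, a), s(b, y)}) := hN.1.subset Set.sdiff_subset
  have hunc : ∀ v, v ∈ coveredBy (N \ {s(x, a), s(b, y)}) →
      v ≠ x ∧ v ≠ a ∧ v ≠ b ∧ v ≠ y := by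
    rintro v ⟨e, ⟨heN, he⟩, hve⟩
    refine ⟨?_, ?_, ?_, ?_⟩ <;> rintro rfl
    · exact he (Or.inl (hN.1.eq_of_mem heN hxaN hve (by simp)))
    · exact he (Or.inl (hN.1.eq_of_mem heN hxaN hve (by simp)))
    · exact he (Or.inr (hN.1.eq_of_mem heN hbyN hve (by simp)))
    · exact he (Or.inr (hN.1.eq_of_mem heN hbyN hve (by simp)))
  -- Exchange `xa`, `by` for `ab`: exactly `x` and `y` become uncovered, so if they were not
  -- adjacent the result would be maximal but not perfect.
  have hM : G.IsEdgeMatching (insert s(a, b) (N \ {s(x, a), s(b, y)})) := by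
    refine hR.insert hab fun v hv hvc => ?_
    rcases Sym2.mem_iff.1 hv with rfl | rfl
    · exact (hunc _ hvc).2.1 rfl
    · exact (hunc _ hvc).2.2.1 rfl
  have hnot : ∀ v, v = x ∨ v = y → v ∉
      coveredBy (insert s(a, b) (N \ {s(x, a), s(b, y)})) := by
    rintro v hv ⟨e, rfl | he, hve⟩
    · rcases Sym2.mem_iff.1 hve with rfl | rfl <;> rcases hv with rfl | rfl
      · exact hxa.ne rfl
      · exact hay rfl
      · exact hxb rfl
      · exact hby.ne rfl
    · have := hunc v ⟨e, he, hve⟩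
      rcases hv with rfl | rfl
      · exact this.1 rfl
      · exact this.2.2.2 rfl
  by_contra hnadj
  refine hnot x (Or.inl rfl) ?_
  rw [hG _ (isMaximalMatching_iff.2 ⟨hM, fun u w huw => ?_⟩)]
  · trivial
  by_contra! hc
  have hmem : ∀ v, v ∉ coveredBy (insert s(a, b) (N \ {s(x, a), s(b, y)})) → v = x ∨ v = y := by
    intro v hv
    obtain ⟨e, he, hve⟩ : v ∈ coveredBy N := hG N hN ▸ Set.mem_univ v
    have hva : v ≠ a := fun h => hv ⟨s(a, b), Or.inl rfl, by simp [h]⟩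
    have hvb : v ≠ b := fun h => hv ⟨s(a, b), Or.inl rfl, by simp [h]⟩
    by_cases hm : e ∈ ({s(x, a), s(b, y)} : Set (Sym2 V))
    · rcases hm with rfl | rfl
      · exact Or.inl ((Sym2.mem_iff.1 hve).resolve_right hva)
      · exact Or.inr ((Sym2.mem_iff.1 hve).resolve_left hvb)
    · exact absurd ⟨e, Or.inr ⟨he, hm⟩, hve⟩ hv
  rcases hmem u hc.1 with rfl | rfl <;> rcases hmem w hc.2 with rfl | rfl
  · exact huw.ne rfl
  · exact hnadj huw
  · exact hnadj huw.symm
  · exact huw.ne rfl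

/-- In a connected graph all of whose maximal matchings are perfect, induced matchings have at
most one edge. -/
theorem inducedMatchingNumber_le_one_of_forall_maximal_covers [Fintype V] (hconn : G.Connected)
    (hG : ∀ M, G.IsMaximalMatching M → coveredBy M = Set.univ) :
    G.inducedMatchingNumber ≤ 1 := by
  obtain ⟨M, hM, hcard⟩ := G.exists_isInducedMatching_ncard_eq
  rw [← hcard, Set.ncard_le_one]
  intro e he f hf
  by_contra hef
  induction e with | _ a b
  induction f with | _ c d
  have hab : G.Adj a b := hM.1.1 he
  have hsep : ∀ u ∈ s(a, b), ∀ w ∈ s(c, d), u ≠ w ∧ ¬ G.Adj u w := by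
    intro u hu w hw
    refine ⟨?_, fun h => hM.2 _ he _ hf hef ⟨s(u, w), h, ⟨u, hu, by simp⟩, ⟨w, hw, by simp⟩⟩⟩
    rintro rfl
    exact hM.1.2 _ he _ hf hef ⟨u, hu, hw⟩
  -- Every vertex is within distance two of `b`, since a path of length three has adjacent ends.
  have hdist : ∀ z, G.Reachable b z → z = b ∨ G.Adj b z ∨ ∃ w, G.Adj b w ∧ G.Adj w z := by
    intro z hz
    rw [reachable_iff_reflTransGen] at hz
    induction hz with
    | refl => exact Or.inl rfl
    | @tail x z _ hxz ih =>
      rcases ih with rfl | h | ⟨w, hbw, hwx⟩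
      · exact Or.inr (Or.inl hxz)
      · exact Or.inr (Or.inr ⟨x, h, hxz⟩)
      · by_cases hbx : b = x
        · subst hbx
          exact Or.inr (Or.inl hxz)
        by_cases hwz : w = z
        · subst hwz
          exact Or.inr (Or.inl hbw)
        by_cases hbz : b = z
        · exact Or.inl hbz.symm
        exact Or.inr (Or.inl
          (adj_of_path_of_forall_maximal_covers hG hbw hwx hxz hbx hwz hbz))
  rcases hdist c (hconn.preconnected b c) with h | h | ⟨w, hbw, hwc⟩
  · exact (hsep b (by simp) c (by simp)).1 h.symm
  · exact (hsep b (by simp) c (by simp)).2 h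
  -- The path `a, b, w, c` would make `a` and `c` adjacent.
  · refine (hsep a (by simp) c (by simp)).2
      (adj_of_path_of_forall_maximal_covers hG hab hbw hwc ?_
        (hsep b (by simp) c (by simp)).1 (hsep a (by simp) c (by simp)).1)
    rintro rfl
    exact (hsep a (by simp) c (by simp)).2 hwc

/-- On at most `2r` vertices, a maximal matching has at least `r` edges and so covers everything. -/
theorem two_mul_lt_of_mem_vertexCounts {p r n : ℕ} (hp : 2 ≤ p) (hn : n ∈ vertexCounts p r r) :
    2 * r < n := by
  obtain ⟨V, _, G, rfl, hconn, hind, hmin, hmatch⟩ := hn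
  by_contra! hle
  have := inducedMatchingNumber_le_one_of_forall_maximal_covers hconn fun M hM => ?_
  · lia
  have h := hM.1.ncard_coveredBy
  have h' := hM.le_ncard
  refine Set.eq_of_subset_of_ncard_le (Set.subset_univ _) ?_
  rw [Set.ncard_univ, Nat.card_eq_fintype_card]
  lia

end RandomlyMatchable

/-! ### Hub graphs -/

/-- The graph with a hub `v` adjacent to all other vertices, in which two other vertices are
adjacent when they have the same colour and are not both in `I`. -/
def hubGraph {V C : Type*} (v : V) (c : V → C) (I : Set V) : SimpleGraph V where
  Adj x y := x ≠ y ∧ (x = v ∨ y = v ∨ (c x = c y ∧ ¬ (x ∈ I ∧ y ∈ I)))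
  symm.symm := by
    rintro x y ⟨h, h'⟩
    refine ⟨h.symm, ?_⟩
    tauto
  loopless.irrefl := fun _ h => h.1 rfl

section Hub

variable {V C : Type*} {v : V} {c : V → C} {I : Set V}

theorem hubGraph_adj {x y : V} : (hubGraph v c I).Adj x y ↔
    x ≠ y ∧ (x = v ∨ y = v ∨ (c x = c y ∧ ¬ (x ∈ I ∧ y ∈ I))) := Iff.rfl

theorem hubGraph_adj_hub {x : V} (h : v ≠ x) : (hubGraph v c I).Adj v x := ⟨h, Or.inl rfl⟩

theorem hubGraph_connected : (hubGraph v c I).Connected := by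
  refine (connected_iff_exists_forall_reachable _).2 ⟨v, fun w => ?_⟩
  by_cases h : v = w
  · exact h ▸ Reachable.refl _
  · exact (hubGraph_adj_hub h).reachable

/-- An edge at the hub excludes all others. Otherwise each edge has an end outside `I`, and such
ends of equal colour are adjacent. -/
theorem inducedMatchingNumber_hubGraph_le [Fintype V] [Fintype C] [Nonempty C] :
    (hubGraph v c I).inducedMatchingNumber ≤ Fintype.card C := by
  obtain ⟨M, hM, hcard⟩ := (hubGraph v c I).exists_isInducedMatching_ncard_eq
  rw [← hcard]
  have : Nonempty V := ⟨v⟩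
  by_cases hv : v ∈ coveredBy M
  · obtain ⟨e, he, hve⟩ := hv
    suffices hM' : M ⊆ {e} by
      have := Set.ncard_le_ncard hM'
      rw [Set.ncard_singleton] at this
      exact this.trans Fintype.card_pos
    intro f hf
    by_contra hfe
    induction f with | _ a b
    have hva : v ≠ a := by
      rintro rfl
      exact hfe (hM.1.eq_of_mem hf he (by simp) hve)
    exact hM.2 e he _ hf (Ne.symm hfe)
      ⟨s(v, a), hubGraph_adj_hub hva, ⟨v, hve, by simp⟩, ⟨a, by simp, by simp⟩⟩
  · have hend : ∀ e ∈ M, ∃ z, z ∈ e ∧ z ∉ I := by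
      intro e he
      induction e with | _ x y
      rcases (hM.1.1 he : (hubGraph v c I).Adj x y).2 with h | h | h
      · exact absurd ⟨s(x, y), he, Sym2.mem_iff.2 (Or.inl h.symm)⟩ hv
      · exact absurd ⟨s(x, y), he, Sym2.mem_iff.2 (Or.inr h.symm)⟩ hv
      · by_cases hx : x ∈ I
        · exact ⟨y, by simp, fun hy => h.2 ⟨hx, hy⟩⟩
        · exact ⟨x, by simp, hx⟩
    choose! z hz hzI using hend
    rw [← Nat.card_eq_fintype_card, ← Set.ncard_univ]
    refine Set.ncard_le_ncard_of_injOn (fun e => c (z e)) (fun _ _ => Set.mem_univ _) ?_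
    intro e he f hf hef
    by_contra hne
    have hzz : z e ≠ z f := fun h => hne (hM.1.eq_of_mem he hf (hz e he) (h ▸ hz f hf))
    exact hM.2 e he f hf hne ⟨s(z e, z f), ⟨hzz, Or.inr (Or.inr ⟨hef, fun h => hzI e he h.1⟩)⟩,
      ⟨z e, hz e he, by simp⟩, ⟨z f, hz f hf, by simp⟩⟩

/-- One edge per colour is induced because, away from the hub, different colours are not adjacent;
with at most one colour there is nothing to separate. -/
theorem le_inducedMatchingNumber_hubGraph [Fintype V] [Fintype C] {x y : C → V}
    (hadj : ∀ i, (hubGraph v c I).Adj (x i) (y i)) (hx : ∀ i, c (x i) = i) (hy : ∀ i, c (y i) = i)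
    (hv : (∀ i, x i ≠ v ∧ y i ≠ v) ∨ Subsingleton C) :
    Fintype.card C ≤ (hubGraph v c I).inducedMatchingNumber := by
  have hinj : Function.Injective (Sum.elim x y) := by
    rintro (i | i) (j | j) h
    · rw [← hx i, ← hx j]; exact congrArg (Sum.inl ∘ c) h
    · obtain rfl : i = j := by rw [← hx i, ← hy j]; exact congrArg c h
      exact absurd h (hadj i).ne
    · obtain rfl : i = j := by rw [← hy i, ← hx j]; exact congrArg c h
      exact absurd h (hadj i).ne'
    · rw [← hy i, ← hy j]; exact congrArg (Sum.inr ∘ c) h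
  rw [← ncard_range_pairing hinj]
  refine IsInducedMatching.ncard_le ⟨isEdgeMatching_range hadj hinj, ?_⟩
  rintro _ ⟨i, rfl⟩ _ ⟨j, rfl⟩ hij ⟨g, hg, ⟨u, hu, hug⟩, ⟨w, hw, hwg⟩⟩
  have hne : i ≠ j := fun h => hij (by rw [h])
  rcases hv with hv | hv
  swap
  · exact hne (Subsingleton.elim _ _)
  have hcu : c u = i ∧ u ≠ v := by
    rcases Sym2.mem_iff.1 hu with rfl | rfl
    exacts [⟨hx i, (hv i).1⟩, ⟨hy i, (hv i).2⟩]
  have hcw : c w = j ∧ w ≠ v := by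
    rcases Sym2.mem_iff.1 hw with rfl | rfl
    exacts [⟨hx j, (hv j).1⟩, ⟨hy j, (hv j).2⟩]
  have huw : u ≠ w := fun h => hne (by rw [← hcu.1, ← hcw.1, h])
  rw [(Sym2.mem_and_mem_iff huw).1 ⟨hug, hwg⟩] at hg
  rcases hg.2 with h | h | h
  · exact hcu.2 h
  · exact hcw.2 h
  · exact hne (by rw [← hcu.1, ← hcw.1, h.1])

/-- A maximal matching of a hub graph covers nearly as many vertices as there are outside `I`. -/
theorem ncard_compl_le_of_isMaximalMatching_hubGraph [Fintype V] [Fintype C]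
    (hc : ∀ i, Even {x | c x = i ∧ x ≠ v}.ncard ∨ (∃ x ∈ I, c x = i) ∨ ∀ x, c x = i)
    {M : Set (Sym2 V)} (hM : (hubGraph v c I).IsMaximalMatching M) :
    Iᶜ.ncard ≤ 2 * M.ncard + 1 := by
  classical
  rw [← hM.1.ncard_coveredBy]
  have hcov := (isMaximalMatching_iff.1 hM).2
  by_cases hv : v ∈ coveredBy M
  swap
  · have hsub : (Iᶜ : Set V) ⊆ insert v (coveredBy M) := by
      intro x _
      by_cases hx : v = x
      · exact Or.inl hx.symm
      · exact Or.inr ((hcov v x (hubGraph_adj_hub hx)).resolve_left hv)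
    exact (Set.ncard_le_ncard hsub).trans (Set.ncard_insert_le _ _)
  obtain ⟨e, he, hve⟩ := hv
  obtain ⟨w, rfl⟩ := Sym2.mem_iff_exists.1 hve
  have hvc : v ∈ coveredBy M := ⟨_, he, by simp⟩
  -- an uncovered vertex outside `I` is the only uncovered vertex of its colour
  have hclass : ∀ u ∉ I, u ∉ coveredBy M → ∀ x, c x = c u → x ≠ u → x ∈ coveredBy M := by
    intro u hu hun x hx hxu
    exact (hcov x u ⟨hxu, Or.inr (Or.inr ⟨hx, fun h => hu h.2⟩)⟩).resolve_right hun
  -- Each colour has at most one uncovered vertex outside `I`; only the colour of the hub's partner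
  -- `w` may incur a net loss.
  have hbound : ∀ i, (Iᶜ ∩ {x | c x = i}).ncard ≤
      (coveredBy M ∩ {x | c x = i}).ncard + if i = c w then 1 else 0 := by
    intro i
    by_cases hall : Iᶜ ∩ {x | c x = i} ⊆ coveredBy M
    · exact le_add_right (Set.ncard_le_ncard fun x hx => ⟨hall hx, hx.2⟩)
    obtain ⟨u, ⟨huI, rfl⟩, hun⟩ := Set.not_subset.1 hall
    have hcl := hclass u huI hun
    split_ifs with hi
    · refine (Set.ncard_le_ncard (t := insert u (coveredBy M ∩ {x | c x = c u})) ?_).trans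
        (Set.ncard_insert_le _ _)
      rintro x ⟨-, hx⟩
      by_cases hxu : x = u
      · exact Or.inl hxu
      · exact Or.inr ⟨hcl x hx hxu, hx⟩
    · rcases hc (c u) with h | ⟨y, hyI, hy⟩ | h
      -- Here `M` does not leave the class minus the hub, so it covers an even number of its
      -- vertices; but it misses exactly `u` from an even set.
      · exfalso
        have hev := hM.1.even_ncard_coveredBy_inter (S := {x | c x = c u ∧ x ≠ v}) ?_
        · have heq : {x | c x = c u ∧ x ≠ v} =
              insert u (coveredBy M ∩ {x | c x = c u ∧ x ≠ v}) := by
            ext x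
            constructor
            · intro hx
              by_cases hxu : x = u
              · exact Or.inl hxu
              · exact Or.inr ⟨hcl x hx.1 hxu, hx⟩
            · rintro (rfl | hx)
              · exact ⟨rfl, fun h => hun (h ▸ hvc)⟩
              · exact hx.2
          rw [heq, Set.ncard_insert_of_notMem fun h => hun h.1] at h
          exact (Nat.even_add_one.1 h) hev
        · rintro f hf a ha b hb ⟨hac, hav⟩
          by_cases hab : a = b
          · exact hab ▸ ⟨hac, hav⟩
          obtain rfl := (Sym2.mem_and_mem_iff hab).1 ⟨ha, hb⟩
          have hbv : b ≠ v := by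
            rintro rfl
            have := hM.1.eq_of_mem he hf (v := b) (by simp) (by simp)
            have haw : a ∈ s(b, w) := this ▸ ha
            rcases Sym2.mem_iff.1 haw with rfl | rfl
            · exact hav rfl
            · exact hi hac.symm
          rcases (hM.1.1 hf : (hubGraph v c I).Adj a b).2 with h | h | h
          · exact absurd h hav
          · exact absurd h hbv
          · exact ⟨h.1.symm.trans hac, hbv⟩
      -- The covered vertex `y` of `I` compensates for `u`.
      · have hsub : Iᶜ ∩ {x | c x = c u} ⊆
            insert u ((coveredBy M ∩ {x | c x = c u}) \ {y}) := by
          rintro x ⟨hxI, hx⟩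
          by_cases hxu : x = u
          · exact Or.inl hxu
          · refine Or.inr ⟨⟨hcl x hx hxu, hx⟩, ?_⟩
            rintro rfl
            exact hxI hyI
        have hyc : y ∈ coveredBy M ∩ {x | c x = c u} :=
          ⟨hcl y hy (fun h => huI (h ▸ hyI)), hy⟩
        have h1 := (Set.ncard_le_ncard hsub).trans (Set.ncard_insert_le _ _)
        rw [Set.ncard_sdiff_singleton_add_one hyc] at h1
        exact h1
      · exact absurd (h w).symm hi
  have hsum : ∀ S : Set V, S.ncard = ∑ i : C, (S ∩ {x | c x = i}).ncard := by
    intro S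
    rw [Set.ncard_eq_toFinset_card', Finset.card_eq_sum_card_fiberwise (f := c) (t := Finset.univ)
      (fun _ _ => Finset.mem_coe.2 (Finset.mem_univ _))]
    refine Finset.sum_congr rfl fun i _ => ?_
    rw [← Set.ncard_coe_finset]
    congr 1
    ext x
    simp
  rw [hsum Iᶜ, hsum (coveredBy M)]
  refine (Finset.sum_le_sum fun i _ => hbound i).trans ?_
  rw [Finset.sum_add_distrib]
  simp

end Hub

/-! ### Extremal examples built from cells -/

section Cells

variable {A B C : Type} [Fintype A] [Fintype B]

/-- The hub graph on four-vertex cells indexed by `A` and two-vertex cells indexed by `B`. -/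
def cellGraph (v : A × Bool × Bool ⊕ B × Bool) (col : A ⊕ B → C) :
    SimpleGraph (A × Bool × Bool ⊕ B × Bool) :=
  hubGraph v (fun x => col (x.map Prod.fst Prod.fst)) {x | ∃ a t, x = Sum.inl (a, true, t)}

/-- `cellGraph` has a perfect matching that respects the cells. -/
theorem exists_isEdgeMatching_cellGraph_perfect (v : A × Bool × Bool ⊕ B × Bool)
    (col : A ⊕ B → C) :
    ∃ M, (cellGraph v col).IsEdgeMatching M ∧ M.ncard = 2 * Fintype.card A + Fintype.card B ∧
      coveredBy M = Set.univ ∧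
      ∀ e ∈ M, ∀ u ∈ e, ∀ w ∈ e, u.map Prod.fst Prod.fst = w.map Prod.fst Prod.fst := by
  let x : A × Bool ⊕ B → A × Bool × Bool ⊕ B × Bool :=
    Sum.elim (fun a => Sum.inl (a.1, false, a.2)) (fun b => Sum.inr (b, false))
  let y : A × Bool ⊕ B → A × Bool × Bool ⊕ B × Bool :=
    Sum.elim (fun a => Sum.inl (a.1, true, a.2)) (fun b => Sum.inr (b, true))
  have hinj : Function.Injective (Sum.elim x y) := by
    rintro ((⟨a, t⟩ | b) | (⟨a, t⟩ | b)) ((⟨a', t'⟩ | b') | (⟨a', t'⟩ | b')) h <;>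
      simp_all [x, y]
  have hcell : ∀ i, (x i).map Prod.fst Prod.fst = (y i).map Prod.fst Prod.fst := by
    rintro (⟨a, t⟩ | b) <;> rfl
  refine ⟨_, isEdgeMatching_range (x := x) (y := y) (fun i => ?_) hinj, ?_, ?_, ?_⟩
  · refine ⟨?_, Or.inr (Or.inr ⟨congrArg col (hcell i), ?_⟩)⟩ <;> rcases i with ⟨a, t⟩ | b <;>
      simp [x, y]
  · rw [ncard_range_pairing hinj]
    simp [mul_comm]
  · rw [coveredBy_range_pairing, Set.eq_univ_iff_forall]
    rintro (⟨a, (_ | _), t⟩ | ⟨b, (_ | _)⟩)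
    · exact Or.inl ⟨Sum.inl (a, t), rfl⟩
    · exact Or.inr ⟨Sum.inl (a, t), rfl⟩
    · exact Or.inl ⟨Sum.inr b, rfl⟩
    · exact Or.inr ⟨Sum.inr b, rfl⟩
  · rintro _ ⟨i, rfl⟩ u hu w hw
    rcases Sym2.mem_iff.1 hu with rfl | rfl <;> rcases Sym2.mem_iff.1 hw with rfl | rfl <;>
      simp [hcell]

/-- `cellGraph` has a matching that covers exactly its clique vertices. -/
theorem exists_isEdgeMatching_cellGraph_compl (v : A × Bool × Bool ⊕ B × Bool)
    (col : A ⊕ B → C) :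
    ∃ M, (cellGraph v col).IsEdgeMatching M ∧ M.ncard = Fintype.card A + Fintype.card B ∧
      coveredBy M = {x | ∃ a t, x = Sum.inl (a, true, t)}ᶜ := by
  let x : A ⊕ B → A × Bool × Bool ⊕ B × Bool :=
    Sum.elim (fun a => Sum.inl (a, false, false)) (fun b => Sum.inr (b, false))
  let y : A ⊕ B → A × Bool × Bool ⊕ B × Bool :=
    Sum.elim (fun a => Sum.inl (a, false, true)) (fun b => Sum.inr (b, true))
  have hinj : Function.Injective (Sum.elim x y) := by
    rintro ((a | b) | (a | b)) ((a' | b') | (a' | b')) h <;> simp_all [x, y]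
  have hcell : ∀ i, (x i).map Prod.fst Prod.fst = (y i).map Prod.fst Prod.fst := by
    rintro (a | b) <;> rfl
  refine ⟨_, isEdgeMatching_range (x := x) (y := y) (fun i => ?_) hinj, ?_, ?_⟩
  · refine ⟨?_, Or.inr (Or.inr ⟨congrArg col (hcell i), ?_⟩)⟩ <;> rcases i with a | b <;>
      simp [x, y]
  · rw [ncard_range_pairing hinj]
    simp
  · rw [coveredBy_range_pairing]
    ext u
    rcases u with ⟨a, (_ | _), (_ | _)⟩ | ⟨b, (_ | _)⟩ <;> simp [x, y]

theorem card_mem_vertexCounts_of_cells [Fintype C] {col : A ⊕ B → C} (hcol : Function.Surjective col)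
    [Nonempty C] (h : Nonempty A ∨ Subsingleton C) :
    2 * (2 * Fintype.card A + Fintype.card B) ∈ vertexCounts (Fintype.card C)
      (Fintype.card A + Fintype.card B) (2 * Fintype.card A + Fintype.card B) := by
  -- The hub avoids `I` so that `I` stays independent. In a four-vertex cell, its colour class also
  -- meets `I`, which exempts that class from the parity condition.
  obtain ⟨v, hvI, hv⟩ : ∃ v : A × Bool × Bool ⊕ B × Bool,
      v ∉ {x : A × Bool × Bool ⊕ B × Bool | ∃ a t, x = Sum.inl (a, true, t)} ∧
        ((∃ a, v = Sum.inl (a, false, false)) ∨ Subsingleton C) := by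
    rcases h with ⟨⟨a⟩⟩ | h
    · exact ⟨_, by simp, Or.inl ⟨a, rfl⟩⟩
    · obtain ⟨a | b, -⟩ := hcol (Classical.arbitrary C)
      exacts [⟨Sum.inl (a, false, false), by simp, Or.inr h⟩,
        ⟨Sum.inr (b, false), by simp, Or.inr h⟩]
  obtain ⟨P, hP, hPcard, hPcov, hPcell⟩ := exists_isEdgeMatching_cellGraph_perfect v col
  obtain ⟨N, hN, hNcard, hNcov⟩ := exists_isEdgeMatching_cellGraph_compl v col
  have hcard : Fintype.card (A × Bool × Bool ⊕ B × Bool) =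
      2 * (2 * Fintype.card A + Fintype.card B) := by
    simp
    ring
  refine ⟨_, inferInstance, cellGraph v col, hcard, hubGraph_connected, ?_, ?_, ?_⟩
  · refine le_antisymm inducedMatchingNumber_hubGraph_le ?_
    -- The index `true` keeps these edges away from a hub at `(a, false, false)`.
    let x : A ⊕ B → A × Bool × Bool ⊕ B × Bool :=
      Sum.elim (fun a => Sum.inl (a, false, true)) (fun b => Sum.inr (b, false))
    let y : A ⊕ B → A × Bool × Bool ⊕ B × Bool :=
      Sum.elim (fun a => Sum.inl (a, true, true)) (fun b => Sum.inr (b, true))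
    have hx : ∀ i, (x i).map Prod.fst Prod.fst = i := by rintro (a | b) <;> rfl
    have hy : ∀ i, (y i).map Prod.fst Prod.fst = i := by rintro (a | b) <;> rfl
    obtain ⟨s, hs⟩ := hcol.hasRightInverse
    refine le_inducedMatchingNumber_hubGraph (x := x ∘ s) (y := y ∘ s) (fun i => ?_)
      (fun i => by simp [hx, hs i]) (fun i => by simp [hy, hs i]) (hv.imp_left ?_)
    · refine ⟨?_, Or.inr (Or.inr ⟨by simp [hx, hy], ?_⟩)⟩ <;>
        rcases hsi : s i with a | b <;> simp [x, y, hsi]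
    · rintro ⟨a, rfl⟩ i
      rcases hsi : s i with a | b <;> simp [x, y, hsi]
  · refine le_antisymm ?_ ?_
    · rw [← hNcard]
      refine (isMaximalMatching_iff.2 ⟨hN, fun u w huw => ?_⟩).le_ncard
      rw [hNcov]
      by_contra! huw'
      simp only [Set.notMem_compl_iff] at huw'
      rcases huw.2 with rfl | rfl | h
      exacts [hvI huw'.1, hvI huw'.2, h.2 huw']
    · obtain ⟨M, hM, hMcard⟩ := (cellGraph v col).exists_isMaximalMatching_ncard_eq
      have hle := ncard_compl_le_of_isMaximalMatching_hubGraph (fun i => ?_) hM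
      -- As `|Iᶜ| = 2q` is even, the possible loss of one vertex is harmless.
      · rw [← hNcov, hN.ncard_coveredBy] at hle
        lia
      rcases hv with ⟨a, rfl⟩ | hC
      swap
      · exact Or.inr (Or.inr fun _ => Subsingleton.elim _ _)
      by_cases hi : col (Sum.inl a) = i
      · exact Or.inr (Or.inl ⟨Sum.inl (a, true, true), ⟨a, true, rfl⟩, hi⟩)
      · left
        have := hP.even_ncard_coveredBy_inter
          (S := {x | col (x.map Prod.fst Prod.fst) = i ∧ x ≠ Sum.inl (a, false, false)}) ?_
        · rwa [hPcov, Set.univ_inter] at this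
        · rintro e he u hu w hw ⟨hui, -⟩
          rw [hPcell e he u hu w hw] at hui
          refine ⟨hui, ?_⟩
          rintro rfl
          exact hi hui
  · have := (cellGraph v col).two_mul_matchingNumber_le
    have := hP.ncard_le
    lia

/-- The hub graph on two-vertex cells indexed by `B` and a hub outside the cells. -/
theorem card_mem_vertexCounts_of_hub_notMem_cells [Fintype C] {col : B → C}
    (hcol : Function.Surjective col) [Nonempty C] :
    2 * Fintype.card B + 1 ∈ vertexCounts (Fintype.card C) (Fintype.card B) (Fintype.card B) := by
  -- The hub's colour is arbitrary: its adjacencies ignore it, and the parity condition omits the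
  -- hub.
  let c : Option (B × Bool) → C := fun o => o.elim (Classical.arbitrary C) fun x => col x.1
  let G := hubGraph none c ∅
  let x : B → Option (B × Bool) := fun b => some (b, false)
  let y : B → Option (B × Bool) := fun b => some (b, true)
  have hinj : Function.Injective (Sum.elim x y) := by
    rintro (b | b) (b' | b') h <;> simp_all [x, y]
  have hadj : ∀ b, G.Adj (x b) (y b) := fun b =>
    ⟨by simp [x, y], Or.inr (Or.inr ⟨rfl, fun h => h.1⟩)⟩
  have hP := isEdgeMatching_range hadj hinj
  have hPcard := ncard_range_pairing hinj
  have hcard : Fintype.card (Option (B × Bool)) = 2 * Fintype.card B + 1 := by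
    simp [mul_comm]
  have hmatch : G.matchingNumber = Fintype.card B := by
    have := G.two_mul_matchingNumber_le
    have := hP.ncard_le
    lia
  refine ⟨_, inferInstance, G, hcard, hubGraph_connected, ?_, ?_, hmatch⟩
  · refine le_antisymm inducedMatchingNumber_hubGraph_le ?_
    obtain ⟨s, hs⟩ := hcol.hasRightInverse
    exact le_inducedMatchingNumber_hubGraph (x := x ∘ s) (y := y ∘ s) (fun i => hadj _)
      hs hs (Or.inl fun i => ⟨by simp [x], by simp [y]⟩)
  · obtain ⟨M, hM, hMcard⟩ := G.exists_isMaximalMatching_ncard_eq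
    have hle := ncard_compl_le_of_isMaximalMatching_hubGraph (fun i => Or.inl ?_) hM
    · have := hM.1.ncard_le
      rw [Set.compl_empty, Set.ncard_univ, Nat.card_eq_fintype_card] at hle
      lia
    have := hP.even_ncard_coveredBy_inter (S := {x | c x = i ∧ x ≠ none}) ?_
    · rwa [Set.inter_eq_right.2] at this
      rw [coveredBy_range_pairing]
      rintro (_ | ⟨b, _ | _⟩) h
      · exact absurd rfl h.2
      · exact Or.inl ⟨b, rfl⟩
      · exact Or.inr ⟨b, rfl⟩
    · rintro _ ⟨b, rfl⟩ u hu w hw ⟨hui, -⟩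
      rcases Sym2.mem_iff.1 hu with rfl | rfl <;> rcases Sym2.mem_iff.1 hw with rfl | rfl <;>
        exact ⟨hui, by simp [x, y]⟩

end Cells

/-! ### The minimum numbers of vertices -/

theorem two_mul_le_of_mem_vertexCounts {p q r n : ℕ} (hn : n ∈ vertexCounts p q r) :
    2 * r ≤ n := by
  obtain ⟨V, _, G, rfl, -, -, -, rfl⟩ := hn
  exact G.two_mul_matchingNumber_le

theorem exists_surjective_fin {α : Type*} [Fintype α] {p : ℕ} (hp : 1 ≤ p)
    (h : p ≤ Fintype.card α) : ∃ f : α → Fin p, Function.Surjective f := by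
  have : Nonempty (Fin p) := ⟨⟨0, hp⟩⟩
  obtain ⟨g⟩ := Function.Embedding.nonempty_of_card_le (α := Fin p) (β := α) (by simpa using h)
  exact ⟨Function.invFun g, Function.invFun_surjective g.injective⟩

theorem isLeast_vertexCounts_two_mul {p q r : ℕ} (hp : 1 ≤ p) (hpq : p ≤ q) (hqr : q ≤ r)
    (hrq : r ≤ 2 * q) (h : p = 1 ∨ q < r) : IsLeast (vertexCounts p q r) (2 * r) := by
  refine ⟨?_, fun n hn => two_mul_le_of_mem_vertexCounts hn⟩
  have : Nonempty (Fin p) := ⟨⟨0, hp⟩⟩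
  -- The cell counts solve `2a + b = r` and `a + b = q`; they are nonnegative because `q ≤ r ≤ 2q`.
  obtain ⟨col, hcol⟩ := exists_surjective_fin (α := Fin (r - q) ⊕ Fin (2 * q - r)) hp
    (by simp; lia)
  have := card_mem_vertexCounts_of_cells hcol ?_
  · simp only [Fintype.card_fin] at this
    convert this using 2 <;> lia
  · rcases h with rfl | h
    · exact Or.inr inferInstance
    · exact Or.inl ⟨⟨0, by lia⟩⟩

theorem isLeast_vertexCounts_two_mul_add_one {p r : ℕ} (hp : 2 ≤ p) (hpr : p ≤ r) :
    IsLeast (vertexCounts p r r) (2 * r + 1) := by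
  refine ⟨?_, fun n hn => two_mul_lt_of_mem_vertexCounts hp hn⟩
  have : Nonempty (Fin p) := ⟨⟨0, by lia⟩⟩
  obtain ⟨col, hcol⟩ := exists_surjective_fin (α := Fin r) (p := p) (by lia) (by simpa using hpr)
  simpa using card_mem_vertexCounts_of_hub_notMem_cells hcol

end SimpleGraph

theorem theorem2p1 (p q r : ℕ) (hp : 1 ≤ p) (hpq : p ≤ q) (hqr : q ≤ r) (hrq : r ≤ 2 * q) :
    IsLeast (SimpleGraph.vertexCounts 1 q r) (2 * r) ∧
    (2 ≤ p → q < r → IsLeast (SimpleGraph.vertexCounts p q r) (2 * r)) ∧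
    (2 ≤ p → q = r → IsLeast (SimpleGraph.vertexCounts p r r) (2 * r + 1)) :=
  ⟨SimpleGraph.isLeast_vertexCounts_two_mul le_rfl (hp.trans hpq) hqr hrq (Or.inl rfl),
    fun _ h => SimpleGraph.isLeast_vertexCounts_two_mul hp hpq hqr hrq (Or.inr h),
    fun h2 h => SimpleGraph.isLeast_vertexCounts_two_mul_add_one h2 (h ▸ hpq)⟩
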